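/- Let $(M,g)$ be a compact smooth Riemannian manifold without boundary, of dimension $d$, with volume measure $dV_g$ (given by $|g|^{1/2}\,dx$ in local coordinates) and Laplace--Beltrami operator $\Delta_g f=|g|^{-1/2}\sum_{i,j}\partial_i\bigl(|g|^{1/2}g^{ij}\partial_j f\bigr)$. For $\lambda\ge 0$ let $E_\lambda$ be the orthogonal projection of $L^2(M)=L^2(M,dV_g;\mathbb C)$ onto the eigenspace $\{e:\Delta_g e=-\lambda^2e\}$; $\lambda$ is a spectral parameter if this eigenspace is nonzero. For $0\ne f\in L^2(M)$ put $$\mathrm{FR}(f)=\frac{\sum_\lambda\|E_\lambda f\|_{L^2(M)}}{\|f\|_{L^2(M)}},$$ where the sum is over all spectral parameters, and for $\Lambda>0$ let $N(\Lambda)=\sum_{\lambda\le\Lambda}\dim\{e:\Delta_g e=-\lambda^2 e\}$ be the Weyl counting function, i.e. the number of spectral parameters $\lambda\le\Lambda$ counted with multiplicity. Call $f$ $\Lambda$-band-limited if $E_\lambda f=0$ for every $\lambda>\Lambda$. **Theorem.** Let $\Lambda>0$, let $f\in L^2(M)$ be nonzero and $\Lambda$-band-limited, let $0<\eta<1$,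 and suppose that there is a linear combination $P$ of $k$ eigenfunctions of $\Delta_g$ (with arbitrary, possibly different, eigenvalues) such that $\|f-P\|_{L^2(M)}\le\eta\,\|f\|_{L^2(M)}$. Then $$\mathrm{FR}(f)\le(1+\eta)\sqrt{k}+\eta\sqrt{N(\Lambda)}.$$ -/

import Mathlib

open MeasureTheory Manifold
open scoped ContDiff ENNReal NNReal

noncomputable section

namespace LaplaceBeltrami

/-- Real `d`-dimensional coordinate space with its Euclidean norm. -/
abbrev Coord (d : ℕ) : Type := EuclideanSpace ℝ (Fin d)

/-- The partial derivative `∂ᵢ F` at `y` of a function on coordinate space. -/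
def partialDeriv {d : ℕ} {V : Type*} [NormedAddCommGroup V] [NormedSpace ℝ V]
    (i : Fin d) (F : Coord d → V) (y : Coord d) : V :=
  fderiv ℝ F y (EuclideanSpace.single i (1 : ℝ))

section

variable {d : ℕ} {M : Type*} [TopologicalSpace M] [ChartedSpace (Coord d) M]

/-- The coordinate vector field `∂ᵢ` of the chart `φ`, at the point of `M` with coordinates `y`. -/
def coordVector (φ : OpenPartialHomeomorph M (Coord d)) (i : Fin d) (y : Coord d) :
    TangentSpace (𝓡 d) (φ.symm y) :=
  mfderiv (𝓡 d) (𝓡 d) φ.symm y (EuclideanSpace.single i (1 : ℝ))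

variable [IsManifold (𝓡 d) ∞ M]

/-- Smooth Riemannian metrics on `M`, that is, on its tangent bundle. -/
abbrev Metric (d : ℕ) (M : Type*) [TopologicalSpace M] [ChartedSpace (Coord d) M]
    [IsManifold (𝓡 d) ∞ M] : Type _ :=
  Bundle.ContMDiffRiemannianMetric (𝓡 d) ∞ (Coord d) (fun x : M => TangentSpace (𝓡 d) x)

/-- The matrix `g_{ij} = ⟨∂ᵢ, ∂ⱼ⟩_g` of the metric in the chart `φ`. -/
def metricMatrix (g : Metric d M) (φ : OpenPartialHomeomorph M (Coord d)) (y : Coord d) :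
    Matrix (Fin d) (Fin d) ℝ :=
  Matrix.of fun i j => g.inner (φ.symm y) (coordVector φ i y) (coordVector φ j y)

/-- The volume density `|g|^{1/2}` in the chart `φ`. -/
def volumeDensity (g : Metric d M) (φ : OpenPartialHomeomorph M (Coord d)) (y : Coord d) : ℝ :=
  Real.sqrt (metricMatrix g φ y).det

/-- The Laplace–Beltrami operator in the chart `φ`,
`Δ_g f = |g|^{-1/2} ∑ᵢⱼ ∂ᵢ (|g|^{1/2} g^{ij} ∂ⱼ f)`, at the point with coordinates `y`. -/
def coordLaplacian (g : Metric d M) (φ : OpenPartialHomeomorph M (Coord d)) (f : M → ℂ)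
    (y : Coord d) : ℂ :=
  (volumeDensity g φ y)⁻¹ • ∑ i : Fin d, ∑ j : Fin d,
    partialDeriv i
      (fun z => (volumeDensity g φ z * (metricMatrix g φ z)⁻¹ i j) •
        partialDeriv j (f ∘ φ.symm) z) y

/-- The smooth function `f` satisfies `Δ_g f = -lam² f` on all of `M`, that is, in all charts. -/
structure IsEigenfunction (g : Metric d M) (lam : ℝ≥0) (f : M → ℂ) : Prop where
  smooth : ContMDiff (𝓡 d) 𝓘(ℝ, ℂ) ∞ f
  eigen : ∀ φ ∈ atlas (Coord d) M, ∀ y ∈ φ.target,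
    coordLaplacian g φ f y = -((lam : ℂ) ^ 2) * f (φ.symm y)

variable [MeasurableSpace M]

/-- The measure `|g|^{1/2} dx` on the domain of the chart `φ`, extended by zero to `M`. -/
def chartVolume (g : Metric d M) (φ : OpenPartialHomeomorph M (Coord d)) : Measure M :=
  ((volume.restrict φ.target).withDensity
    fun y => ENNReal.ofReal (volumeDensity g φ y)).map φ.symm

/-- The Riemannian volume measure `dV_g`. The measures `chartVolume g φ` agree on overlaps of chart
domains, so their supremum (the least measure that dominates all of them) is the measure which on
every chart domain is `|g|^{1/2} dx`. -/
def riemannianVolume (g : Metric d M) : Measure M :=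
  ⨆ φ ∈ atlas (Coord d) M, chartVolume g φ

/-- The Hilbert space `L²(M, dV_g)` of complex-valued functions. -/
abbrev L2 (g : Metric d M) : Type _ := Lp ℂ 2 (riemannianVolume g)

/-- The Laplace–Beltrami eigenfunctions with eigenvalue `-lam²`, as (nonzero) elements of
`L²(M)`. -/
def eigenfunctions (g : Metric d M) (lam : ℝ≥0) : Set (L2 g) :=
  {u | u ≠ 0 ∧ ∃ e : M → ℂ, IsEigenfunction g lam e ∧ u =ᵐ[riemannianVolume g] e}

/-- The `-lam²` eigenspace of `Δ_g`: the eigenfunctions together with `0`. -/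
def eigenspace (g : Metric d M) (lam : ℝ≥0) : Submodule ℂ (L2 g) :=
  Submodule.span ℂ (eigenfunctions g lam)

/-- The orthogonal projection `E_lam` of `L²(M)` onto the `-lam²` eigenspace. (On a compact manifold
the eigenspace is finite-dimensional, hence equal to its closure.) -/
def spectralProjection (g : Metric d M) (lam : ℝ≥0) : L2 g →L[ℂ] L2 g :=
  (eigenspace g lam).topologicalClosure.starProjection

/-- `f` is `L`-band-limited: `E_lam f = 0` for all spectral parameters `lam > L`. -/
def BandLimited (g : Metric d M) (L : ℝ) (f : L2 g) : Prop :=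
  ∀ lam : ℝ≥0, L < lam → spectralProjection g lam f = 0

/-- The spectral `ℓ¹` norm `∑_lam ‖E_lam f‖`, in `[0, ∞]`. Only spectral parameters contribute. -/
def spectralL1Norm (g : Metric d M) (f : L2 g) : ℝ≥0∞ :=
  ∑' lam : ℝ≥0, ‖spectralProjection g lam f‖ₑ

/-- The Fourier ratio of `f ≠ 0`. -/
def fourierRatio (g : Metric d M) (f : L2 g) : ℝ≥0∞ :=
  spectralL1Norm g f / ‖f‖ₑ

/-- The Weyl counting function: the number of spectral parameters at most `L`, each counted with
its multiplicity, the dimension of the eigenspace. -/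
def weylCount (g : Metric d M) (L : ℝ) : ℝ≥0∞ :=
  ∑' lam : {lam : ℝ≥0 // (lam : ℝ) ≤ L},
    ((Cardinal.toENat (Module.rank ℂ (eigenspace g lam.1)) : ℕ∞) : ℝ≥0∞)

end

end LaplaceBeltrami

end

/-! Split `f` as `P + (f - P)` and estimate the spectral `ℓ¹` sums separately. When eigenspaces for
distinct parameters are orthogonal, Bessel's inequality and Cauchy–Schwarz bound a sum of `n`
projection norms of `x` by `√n * ‖x‖`. At most `k` parameters see `P`, and `‖P‖ ≤ (1 + η) * ‖f‖`,
which gives the first term. Since `f` is band-limited, the whole sum may be restricted to spectral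
parameters at most `L`; there are at most `weylCount g L` of these, which gives the second term from
`‖f - P‖ ≤ η * ‖f‖`. This is `sum_norm_starProjection_le_of_approx`.

The analytic input is the orthogonality, which has to be derived from the coordinate formulas. By
Green's identity (`green`), `∫ ⟨du, dv⟩ = lam² ∫ u v` for an eigenfunction `u`; the left side is
symmetric, so two different eigenvalues force `∫ u v = 0`. Green's identity comes from the
divergence form of the Laplacian in one chart and a partition of unity, once the volume and the
gradient pairing are known not to depend on the chart. Neither completeness of the eigenfunctions
nor finite-dimensionality of the eigenspaces is needed. -/

namespace LaplaceBeltrami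

/-! ### Change of charts for the metric, its density and the gradient pairing -/

section LocalGeometry

open Bundle

variable {d : ℕ} {M : Type*} [TopologicalSpace M] [ChartedSpace (Coord d) M]
  [IsManifold (𝓡 d) ∞ M]

theorem contMDiffOn_symm_of_mem_atlas {φ : OpenPartialHomeomorph M (Coord d)}
    (hφ : φ ∈ atlas (Coord d) M) : ContMDiffOn (𝓡 d) (𝓡 d) ∞ φ.symm φ.target :=
  contMDiffOn_symm_of_mem_maximalAtlas (IsManifold.subset_maximalAtlas hφ)

theorem contMDiffOn_of_mem_atlas {φ : OpenPartialHomeomorph M (Coord d)}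
    (hφ : φ ∈ atlas (Coord d) M) : ContMDiffOn (𝓡 d) (𝓡 d) ∞ φ φ.source :=
  contMDiffOn_of_mem_maximalAtlas (IsManifold.subset_maximalAtlas hφ)

/-- The coordinate field is the tangent map of `φ.symm` applied to a constant vector field. -/
theorem contMDiffOn_coordVector {φ : OpenPartialHomeomorph M (Coord d)}
    (hφ : φ ∈ atlas (Coord d) M) (i : Fin d) :
    ContMDiffOn (𝓡 d) ((𝓡 d).prod 𝓘(ℝ, Coord d)) ∞
      (fun y => TotalSpace.mk' (Coord d) (E := fun x : M => TangentSpace (𝓡 d) x)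
        (φ.symm y) (coordVector φ i y)) φ.target := by
  have h1 := (contMDiffOn_symm_of_mem_atlas hφ).contMDiffOn_tangentMapWithin (m := ∞)
    (by simp) φ.open_target.uniqueMDiffOn
  have h2 : ContMDiff (𝓡 d) ((𝓡 d).prod 𝓘(ℝ, Coord d)) ∞
      (fun y : Coord d => (TotalSpace.mk' (Coord d) y (EuclideanSpace.single i (1 : ℝ)) :
        TangentBundle (𝓡 d) (Coord d))) := by
    intro y
    have := contMDiffWithinAt_vectorSpace_iff_contDiffWithinAt (𝕜 := ℝ) (E := Coord d) (n := ∞)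
      (V := fun y => (EuclideanSpace.single i (1 : ℝ) : Coord d)) (s := Set.univ) (x := y)
    rw [← contMDiffWithinAt_univ]
    exact this.2 contDiffWithinAt_const
  have h3 := h1.comp (h2.contMDiffOn (s := φ.target)) (fun y hy => hy)
  refine h3.congr fun y hy => ?_
  simp only [Function.comp, tangentMapWithin, coordVector, TotalSpace.mk']
  rw [mfderivWithin_of_isOpen φ.open_target hy]

theorem contDiffOn_metricMatrix (g : Metric d M) {φ : OpenPartialHomeomorph M (Coord d)}
    (hφ : φ ∈ atlas (Coord d) M) (i j : Fin d) :
    ContDiffOn ℝ ∞ (fun y => metricMatrix g φ y i j) φ.target := by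
  rw [← contMDiffOn_iff_contDiffOn]
  have hg := g.contMDiff.comp_contMDiffOn (contMDiffOn_symm_of_mem_atlas hφ)
  have := ContMDiffOn.clm_bundle_apply₂ (F₁ := Coord d) (F₂ := Coord d) (F₃ := ℝ)
    (E₁ := fun x : M => TangentSpace (𝓡 d) x) (E₂ := fun x : M => TangentSpace (𝓡 d) x)
    (E₃ := Bundle.Trivial M ℝ) hg
    (contMDiffOn_coordVector hφ i) (contMDiffOn_coordVector hφ j)
  intro y hy
  have := this y hy
  simp only [contMDiffWithinAt_totalSpace] at this
  exact this.2

/-- The Jacobian matrix of a self-map of coordinate space. -/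
noncomputable def jacobian {d : ℕ} (T : Coord d → Coord d) (y : Coord d) :
    Matrix (Fin d) (Fin d) ℝ :=
  Matrix.of fun k i => fderiv ℝ T y (EuclideanSpace.single i (1 : ℝ)) k

theorem fderiv_single_eq_sum {d : ℕ} (T : Coord d → Coord d) (y : Coord d) (i : Fin d) :
    fderiv ℝ T y (EuclideanSpace.single i (1 : ℝ)) =
      ∑ k, jacobian T y k i • EuclideanSpace.single k (1 : ℝ) := by
  ext l
  simp [jacobian, Pi.single_apply]

theorem det_jacobian {d : ℕ} (T : Coord d → Coord d) (y : Coord d) :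
    (fderiv ℝ T y).det = (jacobian T y).det := by
  rw [ContinuousLinearMap.det, ← LinearMap.det_toMatrix (EuclideanSpace.basisFun (Fin d) ℝ).toBasis]
  rfl

theorem contDiffAt_transition {φ ψ : OpenPartialHomeomorph M (Coord d)}
    (hφ : φ ∈ atlas (Coord d) M) (hψ : ψ ∈ atlas (Coord d) M) {y : Coord d}
    (hy : y ∈ φ.target) (hyψ : φ.symm y ∈ ψ.source) :
    ContDiffAt ℝ ∞ (ψ ∘ φ.symm) y := by
  rw [← contMDiffAt_iff_contDiffAt]
  exact ((contMDiffOn_of_mem_atlas hψ).contMDiffAt (ψ.open_source.mem_nhds hyψ)).comp y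
    ((contMDiffOn_symm_of_mem_atlas hφ).contMDiffAt (φ.open_target.mem_nhds hy))

/-- The derivative of the inverse of the chart `φ`, as a linear self-map of the model space. -/
noncomputable def coordFrame (φ : OpenPartialHomeomorph M (Coord d)) (y : Coord d) :
    Coord d →L[ℝ] Coord d :=
  mfderiv (𝓡 d) (𝓡 d) φ.symm y

/-- The metric at the point `p`, as a bilinear form on the model space. -/
noncomputable def metricForm (g : Metric d M) (p : M) : Coord d →L[ℝ] Coord d →L[ℝ] ℝ :=
  g.inner p

theorem metricMatrix_apply (g : Metric d M) (φ : OpenPartialHomeomorph M (Coord d))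
    (y : Coord d) (i j : Fin d) :
    metricMatrix g φ y i j = metricForm g (φ.symm y)
      (coordFrame φ y (EuclideanSpace.single i (1 : ℝ)))
      (coordFrame φ y (EuclideanSpace.single j (1 : ℝ))) := rfl

/-- Chain rule for `φ.symm = ψ.symm ∘ (ψ ∘ φ.symm)`, valid near `y`. -/
theorem coordFrame_transition {φ ψ : OpenPartialHomeomorph M (Coord d)}
    (hφ : φ ∈ atlas (Coord d) M) (hψ : ψ ∈ atlas (Coord d) M) {y : Coord d}
    (hy : y ∈ φ.target) (hyψ : φ.symm y ∈ ψ.source) :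
    coordFrame φ y = coordFrame ψ (ψ (φ.symm y)) ∘L fderiv ℝ (ψ ∘ φ.symm) y := by
  have hT : HasMFDerivAt (𝓡 d) (𝓡 d) (ψ ∘ φ.symm) y (fderiv ℝ (ψ ∘ φ.symm) y) :=
    ((contDiffAt_transition hφ hψ hy hyψ).differentiableAt (by simp)).hasFDerivAt.hasMFDerivAt
  have hS := (mdifferentiableAt_atlas_symm (I := 𝓡 d) hψ (ψ.map_source hyψ)).hasMFDerivAt
  have hc := HasMFDerivAt.comp y hS hT
  refine (hc.congr_of_eventuallyEq ?_).mfderiv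
  filter_upwards [(φ.continuousAt_symm hy).preimage_mem_nhds (ψ.open_source.mem_nhds hyψ)] with z hz
  exact (ψ.left_inv hz).symm

theorem bilin_sum_sum {d : ℕ} (B : Coord d →L[ℝ] Coord d →L[ℝ] ℝ) (a b : Fin d → ℝ)
    (v w : Fin d → Coord d) :
    B (∑ k, a k • v k) (∑ l, b l • w l) = ∑ k, ∑ l, a k * B (v k) (w l) * b l := by
  simp only [map_sum, map_smul, sum_apply, smul_apply, smul_eq_mul, Finset.mul_sum]
  rw [Finset.sum_comm]
  refine Finset.sum_congr rfl fun k _ => Finset.sum_congr rfl fun l _ => ?_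
  ring

theorem metricMatrix_transition (g : Metric d M) {φ ψ : OpenPartialHomeomorph M (Coord d)}
    (hφ : φ ∈ atlas (Coord d) M) (hψ : ψ ∈ atlas (Coord d) M) {y : Coord d}
    (hy : y ∈ φ.target) (hyψ : φ.symm y ∈ ψ.source) :
    metricMatrix g φ y = (jacobian (ψ ∘ φ.symm) y).transpose *
      metricMatrix g ψ (ψ (φ.symm y)) * jacobian (ψ ∘ φ.symm) y := by
  ext i j
  rw [metricMatrix_apply, coordFrame_transition hφ hψ hy hyψ]
  simp only [ContinuousLinearMap.comp_apply, fderiv_single_eq_sum, map_sum (coordFrame ψ _),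
    map_smul (coordFrame ψ _)]
  rw [bilin_sum_sum]
  simp only [Matrix.mul_apply, Matrix.transpose_apply, metricMatrix_apply, ψ.left_inv hyψ,
    Finset.sum_mul]
  rw [Finset.sum_comm]

/-- A chart inverse has injective derivative, so positivity of `g` pulls back. The positive
determinant is what makes the density and the inverse matrix smooth. -/
theorem posDef_metricMatrix (g : Metric d M) {φ : OpenPartialHomeomorph M (Coord d)}
    (hφ : φ ∈ atlas (Coord d) M) {y : Coord d} (hy : y ∈ φ.target) :
    (metricMatrix g φ y).PosDef := by
  have hinj : Function.Injective (coordFrame φ y) :=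
    (mdifferentiable_of_mem_atlas (I := 𝓡 d) hφ).symm.mfderiv_injective hy
  refine Matrix.PosDef.of_dotProduct_mulVec_pos ?_ fun x hx => ?_
  · ext i j
    simp only [Matrix.conjTranspose_apply, star_trivial]
    exact g.symm _ _ _
  · have hw : WithLp.toLp 2 x ≠ 0 := by simpa using hx
    have hv : coordFrame φ y (WithLp.toLp 2 x) ≠ 0 := by
      rwa [map_ne_zero_iff _ hinj]
    have hsum : WithLp.toLp 2 x = ∑ i, x i • EuclideanSpace.single i (1 : ℝ) := by
      ext l; simp [Pi.single_apply]
    have hpos : 0 < metricForm g (φ.symm y) (coordFrame φ y (WithLp.toLp 2 x))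
      (coordFrame φ y (WithLp.toLp 2 x)) := g.pos (φ.symm y) _ hv
    simp only [hsum, map_sum (coordFrame φ y), map_smul (coordFrame φ y)] at hpos
    rw [bilin_sum_sum] at hpos
    refine hpos.trans_eq ?_
    simp only [dotProduct, Matrix.mulVec, Finset.mul_sum, Pi.star_apply, star_trivial,
      metricMatrix_apply, mul_assoc]

theorem volumeDensity_pos (g : Metric d M) {φ : OpenPartialHomeomorph M (Coord d)}
    (hφ : φ ∈ atlas (Coord d) M) {y : Coord d} (hy : y ∈ φ.target) :
    0 < volumeDensity g φ y :=
  Real.sqrt_pos.2 (posDef_metricMatrix g hφ hy).det_pos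

/-- Determinants in `G_φ = Jᵀ G_ψ J` give `det J ^ 2`, whose root is the change-of-variables factor.
-/
theorem volumeDensity_transition (g : Metric d M) {φ ψ : OpenPartialHomeomorph M (Coord d)}
    (hφ : φ ∈ atlas (Coord d) M) (hψ : ψ ∈ atlas (Coord d) M) {y : Coord d}
    (hy : y ∈ φ.target) (hyψ : φ.symm y ∈ ψ.source) :
    volumeDensity g φ y =
      |(fderiv ℝ (ψ ∘ φ.symm) y).det| * volumeDensity g ψ (ψ (φ.symm y)) := by
  rw [volumeDensity, metricMatrix_transition g hφ hψ hy hyψ, Matrix.det_mul, Matrix.det_mul,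
    Matrix.det_transpose, det_jacobian, volumeDensity, mul_right_comm, ← sq,
    Real.sqrt_mul (sq_nonneg _), Real.sqrt_sq_eq_abs]

theorem contDiffOn_det_metricMatrix (g : Metric d M) {φ : OpenPartialHomeomorph M (Coord d)}
    (hφ : φ ∈ atlas (Coord d) M) :
    ContDiffOn ℝ ∞ (fun y => (metricMatrix g φ y).det) φ.target := by
  simp only [Matrix.det_apply]
  refine ContDiffOn.sum fun σ _ => ContDiffOn.const_smul _ ?_
  exact contDiffOn_prod fun i _ => contDiffOn_metricMatrix g hφ _ _

theorem contDiffOn_volumeDensity (g : Metric d M) {φ : OpenPartialHomeomorph M (Coord d)}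
    (hφ : φ ∈ atlas (Coord d) M) : ContDiffOn ℝ ∞ (volumeDensity g φ) φ.target :=
  (contDiffOn_det_metricMatrix g hφ).sqrt fun _ hy => (posDef_metricMatrix g hφ hy).det_pos.ne'

theorem contDiffOn_inv_metricMatrix (g : Metric d M) {φ : OpenPartialHomeomorph M (Coord d)}
    (hφ : φ ∈ atlas (Coord d) M) (i j : Fin d) :
    ContDiffOn ℝ ∞ (fun y => (metricMatrix g φ y)⁻¹ i j) φ.target := by
  simp only [Matrix.inv_def, Matrix.smul_apply, Ring.inverse_eq_inv', Matrix.adjugate_apply,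
    smul_eq_mul]
  refine ((contDiffOn_det_metricMatrix g hφ).inv
    fun _ hy => (posDef_metricMatrix g hφ hy).det_pos.ne').mul ?_
  simp only [Matrix.det_apply]
  refine ContDiffOn.sum fun σ _ => ContDiffOn.const_smul _ ?_
  refine contDiffOn_prod fun k _ => ?_
  simp only [Matrix.updateRow_apply]
  split_ifs
  · exact contDiffOn_const
  · exact contDiffOn_metricMatrix g hφ _ _

theorem contDiffOn_comp_symm {φ : OpenPartialHomeomorph M (Coord d)}
    (hφ : φ ∈ atlas (Coord d) M) {u : M → ℂ} (hu : ContMDiff (𝓡 d) 𝓘(ℝ, ℂ) ∞ u) :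
    ContDiffOn ℝ ∞ (u ∘ φ.symm) φ.target := by
  rw [← contMDiffOn_iff_contDiffOn]
  exact hu.comp_contMDiffOn (contMDiffOn_symm_of_mem_atlas hφ)

theorem differentiableAt_comp_symm {φ : OpenPartialHomeomorph M (Coord d)}
    (hφ : φ ∈ atlas (Coord d) M) {u : M → ℂ} (hu : ContMDiff (𝓡 d) 𝓘(ℝ, ℂ) ∞ u)
    {y : Coord d} (hy : y ∈ φ.target) : DifferentiableAt ℝ (u ∘ φ.symm) y :=
  ((contDiffOn_comp_symm hφ hu).contDiffAt (φ.open_target.mem_nhds hy)).differentiableAt (by simp)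

theorem contDiffOn_partialDeriv {d : ℕ} {F : Coord d → ℂ} {s : Set (Coord d)} (hs : IsOpen s)
    (hF : ContDiffOn ℝ ∞ F s) (i : Fin d) : ContDiffOn ℝ ∞ (partialDeriv i F) s :=
  (hF.fderiv_of_isOpen hs (by simp)).clm_apply contDiffOn_const

theorem partialDeriv_transition {φ ψ : OpenPartialHomeomorph M (Coord d)}
    (hφ : φ ∈ atlas (Coord d) M) (hψ : ψ ∈ atlas (Coord d) M) {y : Coord d}
    (hy : y ∈ φ.target) (hyψ : φ.symm y ∈ ψ.source) {u : M → ℂ}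
    (hu : ContMDiff (𝓡 d) 𝓘(ℝ, ℂ) ∞ u) (i : Fin d) :
    partialDeriv i (u ∘ φ.symm) y = ∑ k, (jacobian (ψ ∘ φ.symm) y k i : ℂ) *
      partialDeriv k (u ∘ ψ.symm) (ψ (φ.symm y)) := by
  have h : u ∘ φ.symm =ᶠ[nhds y] (u ∘ ψ.symm) ∘ (ψ ∘ φ.symm) := by
    filter_upwards [(φ.continuousAt_symm hy).preimage_mem_nhds (ψ.open_source.mem_nhds hyψ)]
      with z hz
    exact congrArg u (ψ.left_inv hz).symm
  rw [partialDeriv, h.fderiv_eq, fderiv_comp y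
    (differentiableAt_comp_symm hψ hu (ψ.map_source hyψ))
    ((contDiffAt_transition hφ hψ hy hyψ).differentiableAt (by simp)),
    ContinuousLinearMap.comp_apply, fderiv_single_eq_sum, map_sum]
  simp [partialDeriv]

/-- The pairing `g^{ij} ∂ᵢu ∂ⱼw` of the differentials of two functions in the chart `φ`. -/
noncomputable def coordGradPairing (g : Metric d M) (φ : OpenPartialHomeomorph M (Coord d))
    (u w : M → ℂ) (y : Coord d) : ℂ :=
  ∑ i, ∑ j, ((metricMatrix g φ y)⁻¹ i j : ℂ) * partialDeriv j (u ∘ φ.symm) y *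
    partialDeriv i (w ∘ φ.symm) y

theorem inv_metricMatrix_transition (g : Metric d M) {φ ψ : OpenPartialHomeomorph M (Coord d)}
    (hφ : φ ∈ atlas (Coord d) M) (hψ : ψ ∈ atlas (Coord d) M) {y : Coord d}
    (hy : y ∈ φ.target) (hyψ : φ.symm y ∈ ψ.source) :
    jacobian (ψ ∘ φ.symm) y * (metricMatrix g φ y)⁻¹ * (jacobian (ψ ∘ φ.symm) y).transpose =
      (metricMatrix g ψ (ψ (φ.symm y)))⁻¹ := by
  have h := metricMatrix_transition g hφ hψ hy hyψ
  have hdet := (posDef_metricMatrix g hφ hy).det_pos.ne'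
  have hJ : IsUnit (jacobian (ψ ∘ φ.symm) y).det := by
    rw [h, Matrix.det_mul] at hdet
    exact (right_ne_zero_of_mul hdet).isUnit
  have hJt : IsUnit (jacobian (ψ ∘ φ.symm) y).transpose.det := by rwa [Matrix.det_transpose]
  rw [h, Matrix.mul_inv_rev, Matrix.mul_inv_rev, ← Matrix.mul_assoc,
    Matrix.mul_nonsing_inv _ hJ, Matrix.one_mul, Matrix.mul_assoc,
    Matrix.nonsing_inv_mul _ hJt, Matrix.mul_one]

/-- Differentials transform by `Jᵀ`, and the inverse metric absorbs both factors: `J G_φ⁻¹ Jᵀ =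
G_ψ⁻¹`. -/
theorem coordGradPairing_transition (g : Metric d M) {φ ψ : OpenPartialHomeomorph M (Coord d)}
    (hφ : φ ∈ atlas (Coord d) M) (hψ : ψ ∈ atlas (Coord d) M) {y : Coord d}
    (hy : y ∈ φ.target) (hyψ : φ.symm y ∈ ψ.source) {u w : M → ℂ}
    (hu : ContMDiff (𝓡 d) 𝓘(ℝ, ℂ) ∞ u) (hw : ContMDiff (𝓡 d) 𝓘(ℝ, ℂ) ∞ w) :
    coordGradPairing g φ u w y = coordGradPairing g ψ u w (ψ (φ.symm y)) := by
  -- Both sides are the bilinear form of `G` at `Jᵀ b` and `Jᵀ a`; complex entries are used because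
  -- the derivatives are complex.
  have key : ∀ (J G : Matrix (Fin d) (Fin d) ℂ) (a b : Fin d → ℂ),
      ∑ i, ∑ j, G i j * (∑ l, J l j * a l) * (∑ k, J k i * b k) =
        ∑ k, ∑ l, (J * G * J.transpose) k l * a l * b k := by
    intro J G a b
    have h1 : ∑ i, ∑ j, G i j * (∑ l, J l j * a l) * (∑ k, J k i * b k) =
        (J.transpose.mulVec b) ⬝ᵥ G.mulVec (J.transpose.mulVec a) := by
      simp only [dotProduct, Matrix.mulVec, Matrix.transpose_apply,
        Finset.mul_sum (Finset.univ) _ (∑ k, _)]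
      refine Finset.sum_congr rfl fun i _ => Finset.sum_congr rfl fun j _ => ?_
      ring
    have h2 : ∑ k, ∑ l, (J * G * J.transpose) k l * a l * b k =
        b ⬝ᵥ (J * G * J.transpose).mulVec a := by
      simp only [dotProduct, Matrix.mulVec, Finset.mul_sum]
      refine Finset.sum_congr rfl fun i _ => Finset.sum_congr rfl fun j _ => ?_
      ring
    rw [h1, h2, Matrix.mulVec_transpose, ← Matrix.dotProduct_mulVec, Matrix.mulVec_mulVec,
      Matrix.mulVec_mulVec]
  simp only [coordGradPairing, ← inv_metricMatrix_transition g hφ hψ hy hyψ,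
    partialDeriv_transition hφ hψ hy hyψ hu, partialDeriv_transition hφ hψ hy hyψ hw]
  have := key ((jacobian (ψ ∘ φ.symm) y).map (↑)) ((metricMatrix g φ y)⁻¹.map (↑))
    (fun l => partialDeriv l (u ∘ ψ.symm) (ψ (φ.symm y)))
    (fun l => partialDeriv l (w ∘ ψ.symm) (ψ (φ.symm y)))
  simp only [Matrix.map_apply] at this
  rw [this]
  simp [Matrix.mul_apply]

theorem coordGradPairing_comm (g : Metric d M) {φ : OpenPartialHomeomorph M (Coord d)}
    (hφ : φ ∈ atlas (Coord d) M) {y : Coord d} (hy : y ∈ φ.target) (u w : M → ℂ) :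
    coordGradPairing g φ u w y = coordGradPairing g φ w u y := by
  have hs : ∀ i j, (metricMatrix g φ y)⁻¹ i j = (metricMatrix g φ y)⁻¹ j i := fun i j => by
    simpa using (posDef_metricMatrix g hφ hy).isHermitian.inv.apply j i
  rw [coordGradPairing, coordGradPairing, Finset.sum_comm]
  refine Finset.sum_congr rfl fun i _ => Finset.sum_congr rfl fun j _ => ?_
  rw [hs]
  ring

/-- The pairing `⟨du, dw⟩_g` of the differentials of two functions on `M`. -/
noncomputable def gradPairing (g : Metric d M) (u w : M → ℂ) (p : M) : ℂ :=
  coordGradPairing g (chartAt (Coord d) p) u w (chartAt (Coord d) p p)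

theorem gradPairing_symm_apply (g : Metric d M) {φ : OpenPartialHomeomorph M (Coord d)}
    (hφ : φ ∈ atlas (Coord d) M) {y : Coord d} (hy : y ∈ φ.target) {u w : M → ℂ}
    (hu : ContMDiff (𝓡 d) 𝓘(ℝ, ℂ) ∞ u) (hw : ContMDiff (𝓡 d) 𝓘(ℝ, ℂ) ∞ w) :
    gradPairing g u w (φ.symm y) = coordGradPairing g φ u w y :=
  (coordGradPairing_transition g hφ (chart_mem_atlas _ _) hy (mem_chart_source _ _) hu hw).symm

theorem gradPairing_comm (g : Metric d M) (u w : M → ℂ) (p : M) :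
    gradPairing g u w p = gradPairing g w u p :=
  coordGradPairing_comm g (chart_mem_atlas _ _) (mem_chart_target _ _) u w

theorem gradPairing_sum_right (g : Metric d M) {ι : Type*} (s : Finset ι) (u : M → ℂ)
    {w : ι → M → ℂ} (hw : ∀ i ∈ s, ContMDiff (𝓡 d) 𝓘(ℝ, ℂ) ∞ (w i)) (p : M) :
    gradPairing g u (∑ i ∈ s, w i) p = ∑ i ∈ s, gradPairing g u (w i) p := by
  have hd : ∀ k, partialDeriv k ((∑ i ∈ s, w i) ∘ (chartAt (Coord d) p).symm)
      (chartAt (Coord d) p p) = ∑ i ∈ s, partialDeriv k ((w i) ∘ (chartAt (Coord d) p).symm)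
      (chartAt (Coord d) p p) := by
    intro k
    have : (∑ i ∈ s, w i) ∘ (chartAt (Coord d) p).symm =
        ∑ i ∈ s, (w i ∘ (chartAt (Coord d) p).symm) := by
      ext z; simp
    rw [partialDeriv, this, fderiv_sum fun i hi =>
      differentiableAt_comp_symm (chart_mem_atlas _ _) (hw i hi) (mem_chart_target _ _)]
    simp [partialDeriv]
  simp only [gradPairing, coordGradPairing, hd, Finset.mul_sum]
  rw [Finset.sum_comm]
  simp_rw [Finset.sum_comm (s := s)]
  rw [Finset.sum_comm]

theorem continuousOn_coordGradPairing (g : Metric d M) {φ : OpenPartialHomeomorph M (Coord d)}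
    (hφ : φ ∈ atlas (Coord d) M) {u w : M → ℂ}
    (hu : ContMDiff (𝓡 d) 𝓘(ℝ, ℂ) ∞ u) (hw : ContMDiff (𝓡 d) 𝓘(ℝ, ℂ) ∞ w) :
    ContinuousOn (coordGradPairing g φ u w) φ.target := by
  refine continuousOn_finsetSum _ fun i _ => continuousOn_finsetSum _ fun j _ => ?_
  exact ((Complex.continuous_ofReal.comp_continuousOn
    (contDiffOn_inv_metricMatrix g hφ i j).continuousOn).mul
    (contDiffOn_partialDeriv φ.open_target (contDiffOn_comp_symm hφ hu) j).continuousOn).mul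
    (contDiffOn_partialDeriv φ.open_target (contDiffOn_comp_symm hφ hw) i).continuousOn

end LocalGeometry

/-! ### The Riemannian volume in a chart -/

section Volume

variable {d : ℕ} {M : Type*} [TopologicalSpace M] [ChartedSpace (Coord d) M]
  [IsManifold (𝓡 d) ∞ M] [MeasurableSpace M]

theorem chartVolume_le_riemannianVolume (g : Metric d M) {φ : OpenPartialHomeomorph M (Coord d)}
    (hφ : φ ∈ atlas (Coord d) M) : chartVolume g φ ≤ riemannianVolume g :=
  le_iSup₂ (f := fun φ (_ : φ ∈ atlas (Coord d) M) => chartVolume g φ) φ hφ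

variable [BorelSpace M]

theorem measurableSet_inter_preimage_symm {X Y : Type*} [TopologicalSpace X] [TopologicalSpace Y]
    [MeasurableSpace X] [BorelSpace X] [MeasurableSpace Y] [OpensMeasurableSpace Y]
    (φ : OpenPartialHomeomorph X Y) {A : Set X} (hA : MeasurableSet A) :
    MeasurableSet (φ.target ∩ φ.symm ⁻¹' A) := by
  have hc : Measurable (fun y : φ.target => φ.symm y) :=
    (continuousOn_iff_continuous_domRestrict.1 φ.continuousOn_symm).measurable
  have := φ.open_target.measurableSet.subtype_image (hc hA)
  convert this using 1
  ext y
  simp [and_comm]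

theorem aemeasurable_symm_chart (g : Metric d M) (φ : OpenPartialHomeomorph M (Coord d)) :
    AEMeasurable φ.symm ((volume.restrict φ.target).withDensity
      fun y => ENNReal.ofReal (volumeDensity g φ y)) :=
  (φ.continuousOn_symm.aemeasurable φ.open_target.measurableSet).mono_ac
    (withDensity_absolutelyContinuous _ _)

theorem chartVolume_apply (g : Metric d M) (φ : OpenPartialHomeomorph M (Coord d))
    {A : Set M} (hA : MeasurableSet A) :
    chartVolume g φ A = ∫⁻ y in φ.target ∩ φ.symm ⁻¹' A, ENNReal.ofReal (volumeDensity g φ y) := by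
  rw [chartVolume, Measure.map_apply_of_aemeasurable (aemeasurable_symm_chart g φ) hA,
    withDensity_apply', Measure.restrict_restrict' φ.open_target.measurableSet, Set.inter_comm]

/-- Change of variables along `ψ ∘ φ.symm`, whose Jacobian factor is exactly the ratio of the
densities. -/
theorem chartVolume_eq_of_subset (g : Metric d M) {φ ψ : OpenPartialHomeomorph M (Coord d)}
    (hφ : φ ∈ atlas (Coord d) M) (hψ : ψ ∈ atlas (Coord d) M) {A : Set M} (hA : MeasurableSet A)
    (hAφ : A ⊆ φ.source) (hAψ : A ⊆ ψ.source) : chartVolume g φ A = chartVolume g ψ A := by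
  rw [chartVolume_apply g φ hA, chartVolume_apply g ψ hA]
  have himg : ψ.target ∩ ψ.symm ⁻¹' A = (ψ ∘ φ.symm) '' (φ.target ∩ φ.symm ⁻¹' A) := by
    ext z
    constructor
    · rintro ⟨hz, hzA⟩
      refine ⟨φ (ψ.symm z), ⟨φ.map_source (hAφ hzA), ?_⟩, ?_⟩
      · simpa [φ.left_inv (hAφ hzA)] using hzA
      · simp [φ.left_inv (hAφ hzA), ψ.right_inv hz]
    · rintro ⟨y, ⟨hy, hyA⟩, rfl⟩
      refine ⟨ψ.map_source (hAψ hyA), ?_⟩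
      simpa [ψ.left_inv (hAψ hyA)] using hyA
  have hS := measurableSet_inter_preimage_symm φ hA
  rw [himg, lintegral_image_eq_lintegral_abs_det_fderiv_mul volume hS
    (f' := fun y => fderiv ℝ (ψ ∘ φ.symm) y)]
  · refine setLIntegral_congr_fun hS fun y hy => ?_
    simp only [volumeDensity_transition g hφ hψ hy.1 (hAψ hy.2), Function.comp]
    rw [ENNReal.ofReal_mul (abs_nonneg _)]
  · intro y hy
    exact ((contDiffAt_transition hφ hψ hy.1 (hAψ hy.2)).differentiableAt
      (by simp)).hasFDerivAt.hasFDerivWithinAt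
  · intro y hy z hz hyz
    have := ψ.injOn (hAψ hy.2) (hAψ hz.2) hyz
    exact φ.symm.injOn hy.1 hz.1 this

theorem riemannianVolume_apply (g : Metric d M) {φ : OpenPartialHomeomorph M (Coord d)}
    (hφ : φ ∈ atlas (Coord d) M) {A : Set M} (hA : MeasurableSet A) (hAφ : A ⊆ φ.source) :
    riemannianVolume g A = chartVolume g φ A := by
  refine le_antisymm ?_ (chartVolume_le_riemannianVolume g hφ A)
  have hs := φ.open_source.measurableSet
  -- A supremum of measures is bounded by any common upper bound; this one is infinite off
  -- `φ.source` on nonempty sets, hence says nothing there, and is sharp inside.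
  have hle : riemannianVolume g ≤
      chartVolume g φ + (⊤ : Measure M).restrict φ.sourceᶜ := by
    refine iSup₂_le fun ψ hψ => Measure.le_iff.2 fun B hB => ?_
    have hz : chartVolume g ψ ψ.sourceᶜ = 0 := by
      rw [chartVolume_apply g ψ ψ.open_source.measurableSet.compl]
      have : ψ.target ∩ ψ.symm ⁻¹' ψ.sourceᶜ = ∅ := by
        ext y
        simpa using fun hy => ψ.map_target hy
      rw [this, Measure.restrict_empty, lintegral_zero_measure]
    rw [← measure_inter_add_sdiff B hs, Measure.add_apply,
      Measure.restrict_apply hB]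
    refine add_le_add ?_ ?_
    · calc chartVolume g ψ (B ∩ φ.source)
          ≤ chartVolume g ψ (B ∩ φ.source ∩ ψ.source ∪ ψ.sourceᶜ) :=
            measure_mono fun x hx => by
              by_cases h : x ∈ ψ.source
              · exact Or.inl ⟨hx, h⟩
              · exact Or.inr h
        _ ≤ chartVolume g ψ (B ∩ φ.source ∩ ψ.source) + chartVolume g ψ ψ.sourceᶜ :=
            measure_union_le _ _
        _ = chartVolume g φ (B ∩ φ.source ∩ ψ.source) := by
            rw [hz, add_zero, chartVolume_eq_of_subset g hψ hφ
              ((hB.inter hs).inter ψ.open_source.measurableSet) Set.inter_subset_right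
              (Set.inter_subset_left.trans Set.inter_subset_right)]
        _ ≤ chartVolume g φ B :=
            measure_mono (Set.inter_subset_left.trans Set.inter_subset_left)
    · exact Measure.le_iff'.1 (le_top : chartVolume g ψ ≤ ⊤) _
  calc riemannianVolume g A ≤ _ := hle A
    _ = chartVolume g φ A := by
      have : A ∩ φ.sourceᶜ = ∅ := by
        rw [← Set.sdiff_eq, Set.sdiff_eq_empty.2 hAφ]
      rw [Measure.add_apply, Measure.restrict_apply hA, this, measure_empty, add_zero]

theorem riemannianVolume_restrict_source (g : Metric d M) {φ : OpenPartialHomeomorph M (Coord d)}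
    (hφ : φ ∈ atlas (Coord d) M) :
    (riemannianVolume g).restrict φ.source = chartVolume g φ := by
  ext A hA
  rw [Measure.restrict_apply hA, riemannianVolume_apply g hφ
    (hA.inter φ.open_source.measurableSet) Set.inter_subset_right,
    chartVolume_apply g φ (hA.inter φ.open_source.measurableSet), chartVolume_apply g φ hA]
  congr 2
  ext y
  simp only [Set.mem_inter_iff, Set.mem_preimage]
  exact ⟨fun h => ⟨h.1, h.2.1⟩, fun h => ⟨h.1, h.2, φ.map_target h.1⟩⟩

/-- Transfers integrals to coordinates. The compact `K` supplies integrability, as nothing is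
controlled near the boundary of the chart. -/
theorem integrable_and_integral_eq (g : Metric d M) {φ : OpenPartialHomeomorph M (Coord d)}
    (hφ : φ ∈ atlas (Coord d) M) {f : M → ℂ} {F : Coord d → ℂ} {K : Set (Coord d)}
    (hK : IsCompact K) (hKφ : K ⊆ φ.target) (hF : ContinuousOn F φ.target)
    (hFK : ∀ y ∈ φ.target, y ∉ K → F y = 0) (hfF : ∀ y ∈ φ.target, f (φ.symm y) = F y)
    (hf0 : ∀ p ∉ φ.source, f p = 0) :
    Integrable f (riemannianVolume g) ∧
      ∫ p, f p ∂(riemannianVolume g) = ∫ y in φ.target, volumeDensity g φ y • F y := by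
  have hs := φ.open_source.measurableSet
  have ht := φ.open_target.measurableSet
  have hfc : ContinuousOn f φ.source := by
    refine (hF.comp φ.continuousOn φ.mapsTo).congr fun p hp => ?_
    rw [Function.comp, ← hfF _ (φ.map_source hp), φ.left_inv hp]
  have hfm : AEStronglyMeasurable f (chartVolume g φ) := by
    rw [← riemannianVolume_restrict_source g hφ]
    exact (hfc.aemeasurable hs).aestronglyMeasurable
  have hdm : AEMeasurable (fun y => (volumeDensity g φ y).toNNReal) (volume.restrict φ.target) :=
    ((contDiffOn_volumeDensity g hφ).continuousOn.aemeasurable ht).real_toNNReal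
  have hcongr : ∀ᵐ y ∂(volume.restrict φ.target),
      (volumeDensity g φ y).toNNReal • (f ∘ φ.symm) y = volumeDensity g φ y • F y := by
    filter_upwards [ae_restrict_mem ht] with y hy
    rw [NNReal.smul_def, Real.coe_toNNReal _ (volumeDensity_pos g hφ hy).le, Function.comp,
      hfF y hy]
  have hint : IntegrableOn (fun y => volumeDensity g φ y • F y) φ.target := by
    have h1 : IntegrableOn (fun y => volumeDensity g φ y • F y) K :=
      (((contDiffOn_volumeDensity g hφ).continuousOn.smul hF).mono hKφ).integrableOn_compact hK
    refine h1.of_forall_sdiff_eq_zero ht fun y hy => ?_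
    rw [hFK y hy.1 hy.2, smul_zero]
  have hind : φ.source.indicator f = f :=
    Set.indicator_eq_self.2 fun p hp => by
      by_contra h
      exact hp (hf0 p h)
  constructor
  · rw [← hind, integrable_indicator_iff hs, IntegrableOn, riemannianVolume_restrict_source g hφ,
      chartVolume, integrable_map_measure hfm (aemeasurable_symm_chart g φ)]
    refine (integrable_withDensity_iff_integrable_smul₀ hdm).2 ?_
    exact hint.congr (hcongr.mono fun y hy => hy.symm)
  · conv_lhs => rw [← hind]
    rw [integral_indicator hs, riemannianVolume_restrict_source g hφ,
      chartVolume, integral_map (aemeasurable_symm_chart g φ) hfm]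
    refine (integral_withDensity_eq_integral_smul₀ hdm _).trans ?_
    exact integral_congr_ae hcongr

end Volume

/-! ### Green's identity and orthogonality of eigenfunctions -/

section Green

theorem partialDeriv_eq_zero_of_eqOn_zero {d : ℕ} {G : Coord d → ℂ} {U K : Set (Coord d)}
    (hU : IsOpen U) (hK : IsCompact K) (hGK : ∀ y ∈ U, y ∉ K → G y = 0) (i : Fin d)
    {y : Coord d} (hy : y ∈ U) (hyK : y ∉ K) : partialDeriv i G y = 0 := by
  have : G =ᶠ[nhds y] fun _ => 0 := by
    filter_upwards [hU.mem_nhds hy, hK.isClosed.isOpen_compl.mem_nhds hyK] with z hz hzK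
    exact hGK z hz hzK
  simp [partialDeriv, this.fderiv_eq]

theorem integral_partialDeriv_eq_zero {d : ℕ} {G : Coord d → ℂ} {U K : Set (Coord d)}
    (hU : IsOpen U) (hK : IsCompact K) (hKU : K ⊆ U) (hG : ContDiffOn ℝ ∞ G U)
    (hGK : ∀ y ∈ U, y ∉ K → G y = 0) (i : Fin d) :
    IntegrableOn (partialDeriv i G) U ∧ ∫ y in U, partialDeriv i G y = 0 := by
  set H : Coord d → ℂ := U.indicator G with hH
  have hH0 : ∀ y ∉ K, H y = 0 := fun y hy => by
    by_cases h : y ∈ U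
    · rw [hH, Set.indicator_of_mem h, hGK y h hy]
    · rw [hH, Set.indicator_of_notMem h]
  have hHG : ∀ y ∈ U, H =ᶠ[nhds y] G := fun y hy => by
    filter_upwards [hU.mem_nhds hy] with z hz
    rw [hH, Set.indicator_of_mem hz]
  have hHs : HasCompactSupport H := HasCompactSupport.intro hK hH0
  -- Extension by zero stays smooth: a point outside `U` lies in the open complement of `K`, where
  -- `H` vanishes.
  have hHc : ContDiff ℝ 1 H := by
    rw [contDiff_iff_contDiffAt]
    intro y
    by_cases h : y ∈ U
    · exact ((hG.contDiffAt (hU.mem_nhds h)).of_le (by simp)).congr_of_eventuallyEq (hHG y h)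
    · have : H =ᶠ[nhds y] fun _ => 0 := by
        filter_upwards [hK.isClosed.isOpen_compl.mem_nhds fun hy => h (hKU hy)] with z hz
        exact hH0 z hz
      exact contDiffAt_const.congr_of_eventuallyEq this
  have hd : ∀ y ∈ U, partialDeriv i H y = partialDeriv i G y := fun y hy => by
    rw [partialDeriv, partialDeriv, (hHG y hy).fderiv_eq]
  have hd0 : ∀ y ∉ U, partialDeriv i H y = 0 := fun y hy =>
    partialDeriv_eq_zero_of_eqOn_zero isOpen_univ hK (fun z _ hz => hH0 z hz) i (Set.mem_univ y)
      fun h => hy (hKU h)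
  have hint : Integrable (partialDeriv i H) := by
    have hc : Continuous (partialDeriv i H) :=
      (hHc.continuous_fderiv (by simp)).clm_apply continuous_const
    refine hc.integrable_of_hasCompactSupport (HasCompactSupport.intro hK fun y hy => ?_)
    exact partialDeriv_eq_zero_of_eqOn_zero isOpen_univ hK (fun z _ hz => hH0 z hz) i
      (Set.mem_univ y) hy
  have hzero : ∫ y, partialDeriv i H y = 0 := by
    -- Integration by parts against the constant `1`.
    have := integral_mul_fderiv_eq_neg_fderiv_mul_of_integrable (μ := volume)
      (f := fun _ : Coord d => (1 : ℂ)) (g := H) (v := EuclideanSpace.single i (1 : ℝ))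
      (by simp) (by simpa [partialDeriv] using! hint)
      (by simpa using hHc.continuous.integrable_of_hasCompactSupport hHs)
      (fun y _ => differentiableAt_const _) (fun y _ => hHc.differentiable (by simp) y)
    simpa using! this
  constructor
  · exact (hint.integrableOn (s := U)).congr_fun hd hU.measurableSet
  · rw [← setIntegral_congr_fun hU.measurableSet hd,
      setIntegral_eq_integral_of_forall_compl_eq_zero hd0, hzero]

theorem partialDeriv_comp_symm_eq_zero {d : ℕ} {M : Type*} [TopologicalSpace M]
    {φ : OpenPartialHomeomorph M (Coord d)} {w : M → ℂ}
    {y : Coord d} (hy : y ∈ φ.target) (hw : φ.symm y ∉ tsupport w) (i : Fin d) :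
    partialDeriv i (w ∘ φ.symm) y = 0 := by
  have : w ∘ φ.symm =ᶠ[nhds y] fun _ => 0 := by
    filter_upwards [(φ.continuousAt_symm hy).preimage_mem_nhds
      ((isClosed_tsupport w).isOpen_compl.mem_nhds hw)] with z hz
    exact image_eq_zero_of_notMem_tsupport (f := w) hz
  simp [partialDeriv, this.fderiv_eq]

variable {d : ℕ} {M : Type*} [TopologicalSpace M] [ChartedSpace (Coord d) M]
  [IsManifold (𝓡 d) ∞ M]

/-- By the product rule the integrand is the Euclidean divergence of the field `w |g|^{1/2} g^{ij}
∂ⱼu`, which is supported in `K`. -/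
theorem integral_coordLaplacian_mul_add (g : Metric d M) {φ : OpenPartialHomeomorph M (Coord d)}
    (hφ : φ ∈ atlas (Coord d) M) {u w : M → ℂ}
    (hu : ContMDiff (𝓡 d) 𝓘(ℝ, ℂ) ∞ u) (hw : ContMDiff (𝓡 d) 𝓘(ℝ, ℂ) ∞ w)
    {K : Set (Coord d)} (hK : IsCompact K) (hKφ : K ⊆ φ.target)
    (hwK : ∀ y ∈ φ.target, y ∉ K → w (φ.symm y) = 0) :
    ∫ y in φ.target, volumeDensity g φ y •
      (coordLaplacian g φ u y * w (φ.symm y) + coordGradPairing g φ u w y) = 0 := by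
  have hU := φ.open_target
  set A : Fin d → Fin d → Coord d → ℂ := fun i j z =>
    (volumeDensity g φ z * (metricMatrix g φ z)⁻¹ i j) • partialDeriv j (u ∘ φ.symm) z with hA
  have hAs : ∀ i j, ContDiffOn ℝ ∞ (A i j) φ.target := fun i j =>
    ((contDiffOn_volumeDensity g hφ).mul (contDiffOn_inv_metricMatrix g hφ i j)).smul
      (contDiffOn_partialDeriv hU (contDiffOn_comp_symm hφ hu) j)
  set G : Fin d → Coord d → ℂ := fun i z => (∑ j, A i j z) * (w ∘ φ.symm) z with hG
  have hGs : ∀ i, ContDiffOn ℝ ∞ (G i) φ.target := fun i =>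
    (ContDiffOn.sum fun j _ => hAs i j).mul (contDiffOn_comp_symm hφ hw)
  have hGi := fun i => integral_partialDeriv_eq_zero hU hK hKφ (hGs i)
    (fun y hy hyK => by simp [hG, hwK y hy hyK]) i
  have hpt : ∀ y ∈ φ.target, volumeDensity g φ y •
      (coordLaplacian g φ u y * w (φ.symm y) + coordGradPairing g φ u w y) =
      ∑ i, partialDeriv i (G i) y := by
    intro y hy
    have hAd : ∀ i j, DifferentiableAt ℝ (A i j) y := fun i j =>
      ((hAs i j).contDiffAt (hU.mem_nhds hy)).differentiableAt (by simp)
    have hGd : ∀ i, partialDeriv i (G i) y = (∑ j, partialDeriv i (A i j) y) * w (φ.symm y) +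
        (∑ j, A i j y) * partialDeriv i (w ∘ φ.symm) y := by
      intro i
      rw [partialDeriv, hG, fderiv_fun_mul (DifferentiableAt.fun_sum fun j _ => hAd i j)
        (differentiableAt_comp_symm hφ hw hy), fderiv_fun_sum fun j _ => hAd i j]
      simp [partialDeriv]
      ring
    simp only [hGd, Finset.sum_add_distrib, smul_add]
    congr 1
    · rw [coordLaplacian, smul_mul_assoc, smul_smul,
        mul_inv_cancel₀ (volumeDensity_pos g hφ hy).ne', one_smul, Finset.sum_mul]
    · rw [coordGradPairing, Finset.smul_sum]
      refine Finset.sum_congr rfl fun i _ => ?_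
      rw [Finset.smul_sum, Finset.sum_mul]
      refine Finset.sum_congr rfl fun j _ => ?_
      simp [hA, mul_assoc]
  rw [setIntegral_congr_fun hU.measurableSet hpt, integral_finsetSum _ fun i _ => (hGi i).1]
  exact Finset.sum_eq_zero fun i _ => (hGi i).2

theorem coordGradPairing_eq_zero (g : Metric d M) {φ : OpenPartialHomeomorph M (Coord d)}
    {u w : M → ℂ} {y : Coord d} (hy : y ∈ φ.target) (hw : φ.symm y ∉ tsupport w) :
    coordGradPairing g φ u w y = 0 := by
  simp [coordGradPairing, partialDeriv_comp_symm_eq_zero hy hw]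

theorem gradPairing_eq_zero (g : Metric d M) {u w : M → ℂ} {p : M} (hp : p ∉ tsupport w) :
    gradPairing g u w p = 0 :=
  coordGradPairing_eq_zero g (mem_chart_target _ _) (by simpa using hp)

theorem partialDeriv_conj {d : ℕ} (i : Fin d) (F : Coord d → ℂ) (y : Coord d) :
    partialDeriv i (fun z => starRingEnd ℂ (F z)) y = starRingEnd ℂ (partialDeriv i F y) := by
  have := Complex.conjCLE.comp_fderiv (f := F) (x := y)
  exact DFunLike.congr_fun this (EuclideanSpace.single i (1 : ℝ))

/-- The coefficients of the Laplacian are real. This passes from the bilinear integral `∫ u v` to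
the sesquilinear inner product. -/
theorem IsEigenfunction.conj {g : Metric d M} {lam : ℝ≥0} {u : M → ℂ}
    (hu : IsEigenfunction g lam u) : IsEigenfunction g lam (fun p => starRingEnd ℂ (u p)) where
  smooth := Complex.conjCLE.contDiff.contMDiff.comp hu.smooth
  eigen φ hφ y hy := by
    have h : coordLaplacian g φ (fun p => starRingEnd ℂ (u p)) y =
        starRingEnd ℂ (coordLaplacian g φ u y) := by
      have h1 : ∀ j z, partialDeriv j ((fun p => starRingEnd ℂ (u p)) ∘ φ.symm) z =
          starRingEnd ℂ (partialDeriv j (u ∘ φ.symm) z) := fun j z =>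
        partialDeriv_conj j (u ∘ φ.symm) z
      have h2 : ∀ (a : ℝ) (z : ℂ), a • starRingEnd ℂ z = starRingEnd ℂ (a • z) := fun a z => by
        simp
      simp only [coordLaplacian, h1, h2, partialDeriv_conj, ← map_sum]
    rw [h, hu.eigen φ hφ y hy]
    simp

variable [MeasurableSpace M] [BorelSpace M]

theorem green_of_tsupport_subset [CompactSpace M] (g : Metric d M)
    {φ : OpenPartialHomeomorph M (Coord d)} (hφ : φ ∈ atlas (Coord d) M) {lam : ℝ≥0} {u w : M → ℂ}
    (hu : IsEigenfunction g lam u) (hw : ContMDiff (𝓡 d) 𝓘(ℝ, ℂ) ∞ w)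
    (hwφ : tsupport w ⊆ φ.source) :
    Integrable (fun p => u p * w p) (riemannianVolume g) ∧
      Integrable (gradPairing g u w) (riemannianVolume g) ∧
      ∫ p, gradPairing g u w p ∂(riemannianVolume g) =
        (lam : ℂ) ^ 2 * ∫ p, u p * w p ∂(riemannianVolume g) := by
  have hK : IsCompact (φ '' tsupport w) :=
    (isClosed_tsupport w).isCompact.image_of_continuousOn (φ.continuousOn.mono hwφ)
  have hKφ : φ '' tsupport w ⊆ φ.target := (φ.mapsTo.mono_left hwφ).image_subset
  have hnot : ∀ y ∈ φ.target, y ∉ φ '' tsupport w → φ.symm y ∉ tsupport w :=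
    fun y hy hyK h => hyK ⟨_, h, φ.right_inv hy⟩
  have hwK : ∀ y ∈ φ.target, y ∉ φ '' tsupport w → w (φ.symm y) = 0 :=
    fun y hy hyK => image_eq_zero_of_notMem_tsupport (hnot y hy hyK)
  obtain ⟨i1, e1⟩ := integrable_and_integral_eq g hφ (f := fun p => u p * w p)
    (F := fun y => (u ∘ φ.symm) y * (w ∘ φ.symm) y) hK hKφ
    ((contDiffOn_comp_symm hφ hu.smooth).continuousOn.mul
      (contDiffOn_comp_symm hφ hw).continuousOn)
    (fun y hy hyK => by simp [hwK y hy hyK]) (fun y _ => rfl)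
    (fun p hp => by simp [image_eq_zero_of_notMem_tsupport fun h => hp (hwφ h)])
  obtain ⟨i2, e2⟩ := integrable_and_integral_eq g hφ (f := gradPairing g u w)
    (F := coordGradPairing g φ u w) hK hKφ
    (continuousOn_coordGradPairing g hφ hu.smooth hw)
    (fun y hy hyK => coordGradPairing_eq_zero g hy (hnot y hy hyK))
    (fun y hy => gradPairing_symm_apply g hφ hy hu.smooth hw)
    (fun p hp => gradPairing_eq_zero g fun h => hp (hwφ h))
  -- In coordinates the eigenvalue equation turns this combined integrand into the divergence above,
  -- so its integral vanishes.
  obtain ⟨-, e3⟩ := integrable_and_integral_eq g hφ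
    (f := fun p => gradPairing g u w p - (lam : ℂ) ^ 2 * (u p * w p))
    (F := fun y => coordGradPairing g φ u w y -
      (lam : ℂ) ^ 2 * ((u ∘ φ.symm) y * (w ∘ φ.symm) y)) hK hKφ
    ((continuousOn_coordGradPairing g hφ hu.smooth hw).sub (continuousOn_const.mul
      ((contDiffOn_comp_symm hφ hu.smooth).continuousOn.mul
      (contDiffOn_comp_symm hφ hw).continuousOn)))
    (fun y hy hyK => by
      simp [coordGradPairing_eq_zero g hy (hnot y hy hyK), hwK y hy hyK])
    (fun y hy => by rw [gradPairing_symm_apply g hφ hy hu.smooth hw]; rfl)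
    (fun p hp => by
      simp [gradPairing_eq_zero g fun h => hp (hwφ h),
        image_eq_zero_of_notMem_tsupport fun h => hp (hwφ h)])
  refine ⟨i1, i2, ?_⟩
  rw [integral_sub i2 (i1.const_mul _), integral_const_mul] at e3
  rw [← sub_eq_zero, e3, ← integral_coordLaplacian_mul_add g hφ hu.smooth hw hK hKφ hwK]
  refine setIntegral_congr_fun φ.open_target.measurableSet fun y hy => ?_
  simp only [hu.eigen φ hφ y hy, Function.comp]
  congr 1
  ring

/-- Only `v` is cut up by the partition of unity: the local identity needs `u` to remain an
eigenfunction, but allows any smooth second factor supported in a chart. -/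
theorem green [T2Space M] [CompactSpace M] (g : Metric d M) {lam : ℝ≥0} {u v : M → ℂ}
    (hu : IsEigenfunction g lam u) (hv : ContMDiff (𝓡 d) 𝓘(ℝ, ℂ) ∞ v) :
    ∫ p, gradPairing g u v p ∂(riemannianVolume g) =
      (lam : ℂ) ^ 2 * ∫ p, u p * v p ∂(riemannianVolume g) := by
  -- A finite cover makes the partition a finite sum, which commutes with the integral.
  obtain ⟨t, -, ht⟩ := isCompact_univ.elim_nhds_subcover (fun x : M => (chartAt (Coord d) x).source)
    fun x _ => (chartAt (Coord d) x).open_source.mem_nhds (mem_chart_source _ x)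
  obtain ⟨χ, hχ⟩ := SmoothPartitionOfUnity.exists_isSubordinate (𝓡 d) (isClosed_univ (X := M))
    (fun x : t => (chartAt (Coord d) (x : M)).source) (fun x => (chartAt _ _).open_source)
    (ht.trans_eq (by ext p; simp))
  set w : t → M → ℂ := fun x p => χ x p • v p with hw
  have hws : ∀ x, ContMDiff (𝓡 d) 𝓘(ℝ, ℂ) ∞ (w x) := fun x => (χ x).contMDiff.smul hv
  have hsum : ∑ x, w x = v := by
    ext p
    have := χ.sum_eq_one (Set.mem_univ p)
    rw [finsum_eq_sum_of_fintype] at this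
    simp only [hw, Finset.sum_apply, ← Finset.sum_smul, this, one_smul]
  have hloc := fun x : t => green_of_tsupport_subset g (chart_mem_atlas (Coord d) (x : M)) hu (hws x)
    ((tsupport_smul_subset_left _ _).trans (hχ x))
  have h1 : ∀ p, gradPairing g u v p = ∑ x, gradPairing g u (w x) p := fun p => by
    rw [← gradPairing_sum_right g _ u fun x _ => hws x, hsum]
  have h2 : ∀ p, u p * v p = ∑ x, u p * w x p := fun p => by
    rw [← Finset.mul_sum, ← Finset.sum_apply, hsum]
  simp only [h1, h2]
  rw [integral_finsetSum _ fun x _ => (hloc x).2.1, integral_finsetSum _ fun x _ => (hloc x).1,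
    Finset.mul_sum]
  exact Finset.sum_congr rfl fun x _ => (hloc x).2.2

/-- Green's identity read both ways gives `lam² ∫ u v = mu² ∫ u v`, and squaring is injective on
nonnegative parameters. -/
theorem integral_mul_eq_zero [T2Space M] [CompactSpace M] (g : Metric d M) {lam mu : ℝ≥0}
    (hne : lam ≠ mu) {u v : M → ℂ} (hu : IsEigenfunction g lam u) (hv : IsEigenfunction g mu v) :
    ∫ p, u p * v p ∂(riemannianVolume g) = 0 := by
  have h1 := green g hu hv.smooth
  have h2 := green g hv hu.smooth
  simp only [gradPairing_comm g v u, mul_comm (v _)] at h2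
  rw [h1] at h2
  have h3 : ((lam : ℂ) ^ 2 - (mu : ℂ) ^ 2) * ∫ p, u p * v p ∂(riemannianVolume g) = 0 := by
    rw [sub_mul, h2, sub_self]
  refine (mul_eq_zero.1 h3).resolve_left fun h => hne ?_
  have h4 : (lam : ℝ) ^ 2 = (mu : ℝ) ^ 2 := by exact_mod_cast sub_eq_zero.1 h
  exact NNReal.coe_injective ((sq_eq_sq₀ lam.2 mu.2).1 h4)

theorem inner_eigenfunctions_eq_zero [T2Space M] [CompactSpace M] (g : Metric d M) {lam mu : ℝ≥0}
    (hne : lam ≠ mu) {u v : L2 g} (hu : u ∈ eigenfunctions g lam) (hv : v ∈ eigenfunctions g mu) :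
    inner ℂ u v = 0 := by
  obtain ⟨-, e, he, hue⟩ := hu
  obtain ⟨-, e', he', hve⟩ := hv
  rw [L2.inner_def, ← integral_mul_eq_zero g hne he.conj he']
  refine integral_congr_ae ?_
  filter_upwards [hue, hve] with p h1 h2
  rw [h1, h2, RCLike.inner_apply, mul_comm]

end Green

end LaplaceBeltrami

/-! ### Sums of projection norms in a Hilbert space setting -/

section HilbertSpace

variable {H : Type*} [NormedAddCommGroup H] [InnerProductSpace ℂ H] {ι : Type*}
  {V : ι → Submodule ℂ H} [∀ i, (V i).HasOrthogonalProjection]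

/-- Bessel's inequality: the sum `y` of the projections satisfies `‖y‖² = re ⟪y, x⟫ ≤ ‖y‖ * ‖x‖`. -/
theorem sum_norm_starProjection_sq_le (hV : Pairwise fun i j => V i ⟂ V j) (s : Finset ι) (x : H) :
    ∑ i ∈ s, ‖(V i).starProjection x‖ ^ 2 ≤ ‖x‖ ^ 2 := by
  have hO : OrthogonalFamily ℂ (fun i => V i) fun i => (V i).subtypeₗᵢ :=
    OrthogonalFamily.of_pairwise hV
  set y : H := ∑ i ∈ s, (V i).starProjection x with hy
  have h1 : ‖y‖ ^ 2 = ∑ i ∈ s, ‖(V i).starProjection x‖ ^ 2 :=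
    hO.norm_sum (fun i => (V i).orthogonalProjectionOnto x) s
  have h2 : RCLike.re (inner ℂ y x) = ∑ i ∈ s, ‖(V i).starProjection x‖ ^ 2 := by
    rw [hy, sum_inner, map_sum]
    refine Finset.sum_congr rfl fun i _ => ?_
    exact Submodule.re_inner_starProjection_eq_normSq (V i) x
  have h3 : ‖y‖ ^ 2 ≤ ‖y‖ * ‖x‖ := by
    rw [h1, ← h2]
    exact re_inner_le_norm y x
  rw [← h1]
  nlinarith [norm_nonneg x, norm_nonneg y, sq_nonneg (‖y‖ - ‖x‖)]

theorem sum_norm_starProjection_le (hV : Pairwise fun i j => V i ⟂ V j) (s : Finset ι) (x : H) :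
    ∑ i ∈ s, ‖(V i).starProjection x‖ ≤ √(s.card) * ‖x‖ := by
  refine le_of_sq_le_sq ?_ (by positivity)
  rw [mul_pow, Real.sq_sqrt (Nat.cast_nonneg _)]
  exact sq_sum_le_card_mul_sum_sq.trans
    (mul_le_mul_of_nonneg_left (sum_norm_starProjection_sq_le hV s x) (Nat.cast_nonneg _))

theorem starProjection_sum_eq_zero {κ : Type*} (hV : Pairwise fun i j => V i ⟂ V j)
    (t : Finset κ) (a : κ → ι) {v : κ → H} (hv : ∀ k ∈ t, v k ∈ V (a k)) (c : κ → ℂ) {i : ι}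
    (hi : i ∉ a '' t) : (V i).starProjection (∑ k ∈ t, c k • v k) = 0 := by
  rw [Submodule.starProjection_apply_eq_zero_iff]
  refine Submodule.sum_mem _ fun k hk => Submodule.smul_mem _ _ ?_
  exact (hV fun h => hi ⟨k, hk, h⟩ : V (a k) ⟂ V i) (hv k hk)

theorem sum_norm_starProjection_le_of_approx (hV : Pairwise fun i j => V i ⟂ V j) {k : ℕ}
    (a : Fin k → ι) {v : Fin k → H} (hv : ∀ j, v j ∈ V (a j)) (c : Fin k → ℂ) {f : H} {η : ℝ}
    (h : ‖f - ∑ j, c j • v j‖ ≤ η * ‖f‖) (s : Finset ι) :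
    ∑ i ∈ s, ‖(V i).starProjection f‖ ≤ ((1 + η) * √k + η * √(s.card)) * ‖f‖ := by
  classical
  set p := ∑ j, c j • v j with hp
  have hpf : ‖p‖ ≤ (1 + η) * ‖f‖ := by
    have := norm_sub_le f (f - p)
    rw [sub_sub_cancel] at this
    linarith
  have h1 : ∑ i ∈ s, ‖(V i).starProjection p‖ ≤ √k * ((1 + η) * ‖f‖) := by
    have hsub : ∑ i ∈ s with i ∈ Finset.univ.image a, ‖(V i).starProjection p‖ =
        ∑ i ∈ s, ‖(V i).starProjection p‖ := by
      refine Finset.sum_filter_of_ne fun i _ hi => ?_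
      by_contra hne
      refine hi ?_
      rw [hp, starProjection_sum_eq_zero hV Finset.univ a (fun j _ => hv j) c (by simpa using hne),
        norm_zero]
    -- Several of the `k` vectors may share an eigenspace, so `a` need not be injective and only an
    -- inequality holds.
    have hcard : ((s.filter (· ∈ Finset.univ.image a)).card : ℝ) ≤ k := by
      refine Nat.cast_le.2 ((Finset.card_le_card fun i hi => (Finset.mem_filter.1 hi).2).trans ?_)
      exact Finset.card_image_le.trans_eq (Finset.card_fin k)
    rw [← hsub]
    exact (sum_norm_starProjection_le hV _ p).trans
      (mul_le_mul (Real.sqrt_le_sqrt hcard) hpf (norm_nonneg _) (Real.sqrt_nonneg _))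
  have h2 : ∑ i ∈ s, ‖(V i).starProjection (f - p)‖ ≤ √(s.card) * (η * ‖f‖) :=
    (sum_norm_starProjection_le hV s _).trans (mul_le_mul_of_nonneg_left h (Real.sqrt_nonneg _))
  calc ∑ i ∈ s, ‖(V i).starProjection f‖
      ≤ ∑ i ∈ s, (‖(V i).starProjection p‖ + ‖(V i).starProjection (f - p)‖) := by
        refine Finset.sum_le_sum fun i _ => ?_
        conv_lhs => rw [← add_sub_cancel p f, map_add]
        exact norm_add_le _ _
    _ ≤ √k * ((1 + η) * ‖f‖) + √(s.card) * (η * ‖f‖) := by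
        rw [Finset.sum_add_distrib]
        exact add_le_add h1 h2
    _ = _ := by ring

end HilbertSpace

namespace LaplaceBeltrami

/-! ### Spectral projections and the counting function -/

section Spectral

variable {d : ℕ} {M : Type*} [TopologicalSpace M] [ChartedSpace (Coord d) M]
  [IsManifold (𝓡 d) ∞ M] [MeasurableSpace M]

theorem pairwise_isOrtho_closure_eigenspace [BorelSpace M] [T2Space M] [CompactSpace M]
    (g : Metric d M) :
    Pairwise fun lam mu => (eigenspace g lam).topologicalClosure ⟂
      (eigenspace g mu).topologicalClosure := by
  intro lam mu hne
  have h : eigenspace g lam ⟂ eigenspace g mu :=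
    Submodule.isOrtho_span.2 fun u hu v hv => inner_eigenfunctions_eq_zero g hne hu hv
  rw [Submodule.isOrtho_iff_le, Submodule.orthogonal_closure]
  exact Submodule.topologicalClosure_minimal _ h (Submodule.isClosed_orthogonal _)

theorem spectralProjection_eq_zero (g : Metric d M) {lam : ℝ≥0} (h : eigenspace g lam = ⊥)
    (f : L2 g) : spectralProjection g lam f = 0 := by
  have hb : (eigenspace g lam).topologicalClosure = ⊥ := by
    rw [h]
    exact (isClosed_singleton (x := (0 : L2 g))).submodule_topologicalClosure_eq
  rw [spectralProjection, Submodule.starProjection_apply_eq_zero_iff, hb]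
  simp

/-- Every nonzero eigenspace has multiplicity at least one; an infinite rank would only enlarge the
right side. -/
theorem card_le_weylCount (g : Metric d M) (L : ℝ) (s : Finset ℝ≥0)
    (hs : ∀ lam ∈ s, (lam : ℝ) ≤ L ∧ eigenspace g lam ≠ ⊥) : (s.card : ℝ≥0∞) ≤ weylCount g L := by
  classical
  set t : Finset {lam : ℝ≥0 // (lam : ℝ) ≤ L} := s.subtype _ with ht
  have hcard : t.card = s.card := by
    rw [ht, Finset.card_subtype, Finset.filter_true_of_mem fun lam hl => (hs lam hl).1]
  rw [← hcard, weylCount]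
  refine le_trans ?_ (ENNReal.sum_le_tsum t)
  rw [Finset.card_eq_sum_ones, Nat.cast_sum]
  refine Finset.sum_le_sum fun lam hl => ?_
  have hne := (hs lam.1 (Finset.mem_subtype.1 hl)).2
  have : Nontrivial (eigenspace g lam.1) := Submodule.nontrivial_iff_ne_bot.2 hne
  have h1 : (1 : ℕ∞) ≤ Cardinal.toENat (Module.rank ℂ (eigenspace g lam.1)) := by
    rw [← map_one Cardinal.toENat]
    exact Cardinal.toENat.monotone' (Cardinal.one_le_iff_pos.2 rank_pos)
  simpa using ENat.toENNReal_mono h1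

end Spectral

end LaplaceBeltrami

theorem mainTheorem7 {d : ℕ} {M : Type*} [TopologicalSpace M] [T2Space M] [CompactSpace M]
    [ChartedSpace (EuclideanSpace ℝ (Fin d)) M] [IsManifold (𝓡 d) ∞ M]
    [MeasurableSpace M] [BorelSpace M]
    (g : LaplaceBeltrami.Metric d M)
    (L : ℝ) (hL : 0 < L)
    (f : LaplaceBeltrami.L2 g) (hf : f ≠ 0) (hband : LaplaceBeltrami.BandLimited g L f)
    (η : ℝ) (hη0 : 0 < η) (hη1 : η < 1)
    (k : ℕ) (lam : Fin k → ℝ≥0) (e : Fin k → LaplaceBeltrami.L2 g)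
    (he : ∀ i, e i ∈ LaplaceBeltrami.eigenfunctions g (lam i))
    (c : Fin k → ℂ)
    (happrox : ‖f - ∑ i, c i • e i‖ ≤ η * ‖f‖) :
    LaplaceBeltrami.fourierRatio g f ≤
      ENNReal.ofReal ((1 + η) * Real.sqrt k) +
        ENNReal.ofReal η * LaplaceBeltrami.weylCount g L ^ (1 / 2 : ℝ) := by
  classical
  rw [LaplaceBeltrami.fourierRatio, ENNReal.div_le_iff (by simpa using hf) (by simp),
    -- It suffices to bound finite partial sums, so neither convergence nor finiteness of `weylCount
    -- g L` has to be known beforehand.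
    LaplaceBeltrami.spectralL1Norm, ENNReal.tsum_eq_iSup_sum]
  refine iSup_le fun s => ?_
  -- The discarded terms vanish by band-limitation or by triviality of the eigenspace. This is done
  -- for `f` before splitting, since `P` need not be band-limited.
  set s' := s.filter fun mu : ℝ≥0 => (mu : ℝ) ≤ L ∧ LaplaceBeltrami.eigenspace g mu ≠ ⊥ with hs'
  have hsum : ∑ mu ∈ s, ‖LaplaceBeltrami.spectralProjection g mu f‖ₑ =
      ∑ mu ∈ s', ‖LaplaceBeltrami.spectralProjection g mu f‖ₑ := by
    refine (Finset.sum_filter_of_ne fun mu _ hne => ⟨?_, fun hbot => hne ?_⟩).symm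
    · by_contra hlt
      exact hne (by rw [hband mu (not_le.1 hlt), enorm_zero])
    · rw [LaplaceBeltrami.spectralProjection_eq_zero g hbot, enorm_zero]
  have hreal := sum_norm_starProjection_le_of_approx
    (LaplaceBeltrami.pairwise_isOrtho_closure_eigenspace g) lam
    (fun i => Submodule.le_topologicalClosure _ (Submodule.subset_span (he i))) c happrox s'
  have hcard := LaplaceBeltrami.card_le_weylCount g L s' fun mu hmu => (Finset.mem_filter.1 hmu).2
  have hsqrt : ENNReal.ofReal √(s'.card) ≤ LaplaceBeltrami.weylCount g L ^ (1 / 2 : ℝ) := by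
    rw [Real.sqrt_eq_rpow, ← ENNReal.ofReal_rpow_of_nonneg (Nat.cast_nonneg _) (by norm_num),
      ENNReal.ofReal_natCast]
    exact ENNReal.rpow_le_rpow hcard (by norm_num)
  rw [hsum]
  calc ∑ mu ∈ s', ‖LaplaceBeltrami.spectralProjection g mu f‖ₑ
      = ENNReal.ofReal (∑ mu ∈ s', ‖LaplaceBeltrami.spectralProjection g mu f‖) := by
        rw [ENNReal.ofReal_sum_of_nonneg fun _ _ => norm_nonneg _]
        simp only [ofReal_norm]
    _ ≤ ENNReal.ofReal (((1 + η) * √k + η * √(s'.card)) * ‖f‖) := ENNReal.ofReal_le_ofReal hreal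
    _ = (ENNReal.ofReal ((1 + η) * √k) + ENNReal.ofReal η * ENNReal.ofReal √(s'.card)) * ‖f‖ₑ := by
        rw [ENNReal.ofReal_mul (by positivity), ENNReal.ofReal_add (by positivity) (by positivity),
          ENNReal.ofReal_mul hη0.le, ofReal_norm]
    _ ≤ _ := by gcongr
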